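/- **Definitions.** Let $(\mathbb{P},\le)$ be a poset. A *band* is a finite $B\subseteq\mathbb{P}$ such that every $p\in\mathbb{P}$ is comparable to some $b\in B$. A *cap* is a subset $C\subseteq\mathbb{P}$ such that, for some band $B$, every $b\in B$ lies below some $c\in C$; $\mathsf{C}\mathbb{P}$ denotes the set of caps. Write $p\wedge q$ if $p$ and $q$ have a common lower bound and $Cp=\{c\in C: c\wedge p\}$. Write $q\vartriangleright p$ (or $p\vartriangleleft q$) if there is a cap $C$ with $c\le q$ for all $c\in Cp$. A *selector* is a subset of $\mathbb{P}$ meeting every cap. The *spectrum* $\mathsf{S}\mathbb{P}$ is the set of (inclusion-)minimal selectors with the topology generated by the sets $p^\in=\{S\in\mathsf{S}\mathbb{P}:p\in S\}$, $p\in\mathbb{P}$. The poset $\mathbb{P}$ is * an *$\omega$-poset* if every principal filter $\{q:q\ge p\}$ is finite and, for each $n$, only finitely many principal filters have exactly $n$ elements; * *regular* if for every cap $C$ there is a cap $D$ such that every $d\in D$ satisfies $d\vartriangleleft c$ for some $c\in C$; * *prime* if every $p\in\mathbb{P}$ lies in some minimal selector. A relation ${\sqsupset}\subseteq\mathbb{Q}\times\mathbb{P}$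 between posets is a *refiner* if for every cap $C$ of $\mathbb{Q}$ there is a cap $D$ of $\mathbb{P}$ such that every $d\in D$ satisfies $c\sqsupset d$ for some $c\in C$. It is *$\wedge$-preserving* if $q\sqsupset p$, $p\wedge p'$ and $q'\sqsupset p'$ imply $q\wedge q'$. Its *star* is given by $q\sqsupset^*p$ if and only if there is $C\in\mathsf{C}\mathbb{P}$ with $q\sqsupset c$ for all $c\in Cp$. The *star-composition* of ${\sqsupset'}\subseteq\mathbb{R}\times\mathbb{Q}$ and ${\sqsupset}\subseteq\mathbb{Q}\times\mathbb{P}$ is ${\sqsupset'*\sqsupset}=(\sqsupset'\circ\sqsupset)^*$, where $\circ$ is the usual composition of relations. A *strong refiner* is a $\wedge$-preserving refiner ${\sqsupset}\subseteq\mathbb{Q}\times\mathbb{P}$ with ${\sqsupset}={\vartriangleright_{\mathbb{Q}}*\sqsupset}$. Let $\mathbf{K}$ be the category of metrisable compact spaces and continuous maps. Let $\mathbf{P}$ be the category whose objects are the regular prime $\omega$-posets and whose morphisms $\mathbb{P}\to\mathbb{Q}$ are the $\wedge$-preserving refiners ${\sqsupset}\subseteq\mathbb{Q}\times\mathbb{P}$,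 with composition $\circ$ and identities the equality relations. Let $\mathbf{S}$ be the category with the same objects, whose morphisms $\mathbb{P}\to\mathbb{Q}$ are the strong refiners ${\sqsupset}\subseteq\mathbb{Q}\times\mathbb{P}$, with composition $*$ and identities $\vartriangleright_{\mathbb{P}}$. Let $\mathsf{S}$ be the map sending a regular prime $\omega$-poset $\mathbb{P}$ to its spectrum $\mathsf{S}\mathbb{P}$ and a $\wedge$-preserving refiner ${\sqsupset}\subseteq\mathbb{Q}\times\mathbb{P}$ to the continuous map $\phi_\sqsupset:\mathsf{S}\mathbb{P}\to\mathsf{S}\mathbb{Q}$, $$\phi_\sqsupset(S)=\{q\in\mathbb{Q}:\ \exists\,s\in S\ \exists\,q'\in\mathbb{Q}\ \ (q\vartriangleright q'\sqsupset s)\}.$$ **Theorem.** $\mathsf{S}$ is a functor from $\mathbf{P}$ to $\mathbf{K}$. Its restriction $\mathsf{S}|_{\mathbf{S}}:\mathbf{S}\to\mathbf{K}$ to strong refiners is a functor which is full, faithful and essentially surjective; in other words, it is an equivalence of categories. Moreover, the map $\mathsf{Q}$ that is the identity on objects and is given by $\mathsf{Q}(\sqsupset)={\vartriangleright*\sqsupset}$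 on morphisms is a functor from $\mathbf{P}$ to $\mathbf{S}$, and $\mathsf{S}=\mathsf{S}|_{\mathbf{S}}\circ\mathsf{Q}$. -/

import Mathlib

open CategoryTheory

universe u

namespace OmegaPoset

section Order

variable {P : Type*} [PartialOrder P]

/-- A band is a finite subset such that every element of the poset is comparable to some
element of it. -/
def IsBand (B : Set P) : Prop :=
  B.Finite ∧ ∀ p, ∃ b ∈ B, p ≤ b ∨ b ≤ p

/-- A cap is a subset refined by some band. -/
def IsCap (C : Set P) : Prop :=
  ∃ B, IsBand B ∧ ∀ b ∈ B, ∃ c ∈ C, b ≤ c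

/-- The common lower bound relation `p ∧ q`. -/
def Compat (p q : P) : Prop :=
  ∃ r, r ≤ p ∧ r ≤ q

/-- `C p = {c ∈ C | c ∧ p}`, the star of `p` in `C`. -/
def starOf (C : Set P) (p : P) : Set P :=
  {c | c ∈ C ∧ Compat c p}

/-- The star-above relation: `StarAbove q p` is `q ▷ p` (equivalently `p ◁ q`), meaning that all
elements of the star of `p` in some cap lie below `q`. -/
def StarAbove (q p : P) : Prop :=
  ∃ C : Set P, IsCap C ∧ ∀ c ∈ starOf C p, c ≤ q

/-- A selector overlaps every cap. -/
def IsSelector (S : Set P) : Prop :=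
  ∀ C : Set P, IsCap C → (S ∩ C).Nonempty

/-- The up-closure `S^◁` of `S` with respect to the star-below relation. -/
def starUp (S : Set P) : Set P :=
  {q | ∃ p ∈ S, StarAbove q p}

variable (P)

/-- An ω-poset: every principal filter is finite and, for each `n`, there are only finitely many
principal filters with `n` elements (in a poset a principal filter has a unique generator, so we
count generators). -/
def IsOmega : Prop :=
  (∀ p : P, (Set.Ici p).Finite) ∧ ∀ n : ℕ, {p : P | (Set.Ici p).ncard = n}.Finite

/-- A poset is regular if every cap is `◁`-refined by a cap. -/
def IsRegular : Prop :=
  ∀ C : Set P, IsCap C → ∃ D : Set P, IsCap D ∧ ∀ d ∈ D, ∃ c ∈ C, StarAbove c d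

/-- A poset is prime if every element lies in some minimal selector. -/
def IsPrime : Prop :=
  ∀ p : P, ∃ S : Set P, Minimal IsSelector S ∧ p ∈ S

/-- The spectrum of a poset: the set of minimal selectors. -/
@[ext]
structure Spectrum where
  carrier : Set P
  minimal : Minimal IsSelector carrier

/-- The topology of the spectrum is generated by the sets `p^∈ = {S | p ∈ S}`. -/
instance : TopologicalSpace (Spectrum P) :=
  TopologicalSpace.generateFrom (Set.range fun p : P => {S : Spectrum P | p ∈ S.1})

end Order

section Relations

variable {P Q R : Type*} [PartialOrder P] [PartialOrder Q] [PartialOrder R]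

/-- A relation `⊐ ⊆ Q × P` is a refiner if each cap of `Q` is refined by some cap of `P`. -/
def IsRefiner (r : Q → P → Prop) : Prop :=
  ∀ C : Set Q, IsCap C → ∃ D : Set P, IsCap D ∧ ∀ d ∈ D, ∃ c ∈ C, r c d

/-- `⊐ ⊆ Q × P` is `∧`-preserving. -/
def WedgePreserving (r : Q → P → Prop) : Prop :=
  ∀ ⦃q p p' q'⦄, r q p → Compat p p' → r q' p' → Compat q q'

/-- The star of a relation: `q ⊐* p` iff `C p ⊏ q` for some cap `C` of `P`. -/
def star (r : Q → P → Prop) (q : Q) (p : P) : Prop :=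
  ∃ C : Set P, IsCap C ∧ ∀ c ∈ starOf C p, r q c

/-- Star-composition of relations, the star of the usual composition. -/
def starComp (s : R → Q → Prop) (r : Q → P → Prop) : R → P → Prop :=
  star (Relation.Comp s r)

/-- The up-closure `S^⊏` of `S ⊆ P` along a relation `⊐ ⊆ Q × P`. -/
def relUp (r : Q → P → Prop) (S : Set P) : Set Q :=
  {q | ∃ p ∈ S, r q p}

end Relations

/-! ### Basic facts about caps -/

section Caps

variable {P : Type*} [PartialOrder P]

theorem Compat.symm {p q : P} (h : Compat p q) : Compat q p :=
  let ⟨r, h1, h2⟩ := h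
  ⟨r, h2, h1⟩

theorem Compat.mono {p q p' q' : P} (h : Compat p q) (hp : p ≤ p') (hq : q ≤ q') :
    Compat p' q' :=
  let ⟨r, h1, h2⟩ := h
  ⟨r, h1.trans hp, h2.trans hq⟩

theorem Compat.refl (p : P) : Compat p p := ⟨p, le_rfl, le_rfl⟩

theorem IsCap.of_refines {C D : Set P} (hC : IsCap C) (h : ∀ c ∈ C, ∃ d ∈ D, c ≤ d) :
    IsCap D := by
  obtain ⟨B, hB, hBC⟩ := hC
  refine ⟨B, hB, fun b hb => ?_⟩
  obtain ⟨c, hc, hbc⟩ := hBC b hb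
  obtain ⟨d, hd, hcd⟩ := h c hc
  exact ⟨d, hd, hbc.trans hcd⟩

theorem IsCap.finite_subcap {C : Set P} (hC : IsCap C) :
    ∃ F ⊆ C, F.Finite ∧ IsCap F := by
  obtain ⟨B, hB, hBC⟩ := hC
  choose! f hf hbf using hBC
  exact ⟨f '' B, by rintro _ ⟨b, hb, rfl⟩; exact hf b hb, hB.1.image f, B, hB,
    fun b hb => ⟨f b, ⟨b, hb, rfl⟩, hbf b hb⟩⟩

theorem Compat.split {p q : P} (h : Compat p q) {C : Set P} (hC : IsCap C) :
    ∃ c ∈ C, Compat p c ∧ Compat c q := by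
  obtain ⟨r, hp, hq⟩ := h
  obtain ⟨B, hB, hBC⟩ := hC
  obtain ⟨b, hb, h⟩ := hB.2 r
  obtain ⟨c, hc, hbc⟩ := hBC b hb
  rcases h with h | h
  · exact ⟨c, hc, ⟨r, hp, h.trans hbc⟩, ⟨r, h.trans hbc, hq⟩⟩
  · exact ⟨c, hc, ⟨b, h.trans hp, hbc⟩, ⟨b, hbc, h.trans hq⟩⟩

theorem Compat.starAbove {p q r : P} (h : Compat p q) (hr : StarAbove r q) : Compat p r := by
  obtain ⟨C, hC, hle⟩ := hr
  obtain ⟨c, hc, hpc, hcq⟩ := h.split hC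
  exact hpc.mono le_rfl (hle c ⟨hc, hcq⟩)

theorem StarAbove.mono {p q q' : P} (h : StarAbove q p) (hq : q ≤ q') : StarAbove q' p :=
  let ⟨C, hC, hle⟩ := h
  ⟨C, hC, fun c hc => (hle c hc).trans hq⟩

/-- In an ω-poset, any two caps have a common refinement. -/
theorem IsOmega.exists_common (hP : IsOmega P) {C D : Set P} (hC : IsCap C) (hD : IsCap D) :
    ∃ A : Set P, IsCap A ∧ (∀ a ∈ A, ∃ c ∈ C, a ≤ c) ∧ ∀ a ∈ A, ∃ d ∈ D, a ≤ d := by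
  obtain ⟨B₁, hB₁, h₁⟩ := hC
  obtain ⟨B₂, hB₂, h₂⟩ := hD
  let U : Set P := ⋃ b ∈ B₁ ∪ B₂, Set.Ici b
  have hUfin : U.Finite := (hB₁.1.union hB₂.1).biUnion fun b _ => hP.1 b
  have hmemU : ∀ b ∈ B₁ ∪ B₂, ∀ p, b ≤ p → p ∈ U := fun b hb p hbp =>
    Set.mem_biUnion hb hbp
  have hUup : ∀ p ∈ U, ∀ q, p ≤ q → q ∈ U := by
    intro p hp q hpq
    obtain ⟨b, hb, hbp⟩ := Set.mem_iUnion₂.1 hp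
    exact hmemU b hb q (le_trans hbp hpq)
  let T : Set P := {p | p ∉ U ∧ ∀ q, p < q → q ∈ U}
  have hTfin : T.Finite := by
    refine ((Set.finite_Iic (U.ncard + 1)).biUnion fun n _ => hP.2 n).subset ?_
    intro p hp
    refine Set.mem_biUnion (x := (Set.Ici p).ncard) ?_ rfl
    have hsub : Set.Ici p ⊆ insert p U := by
      intro q hq
      rcases eq_or_lt_of_le (show p ≤ q from hq) with h | h
      · exact Or.inl h.symm
      · exact Or.inr (hp.2 q h)
    exact (Set.ncard_le_ncard hsub (hUfin.insert p)).trans (Set.ncard_insert_le p U)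
  have hTtop : ∀ p, p ∉ U → ∃ t ∈ T, p ≤ t := by
    intro p hp
    obtain ⟨t, ht⟩ := ((hP.1 p).subset (Set.sdiff_subset (t := U))).exists_maximal
      ⟨p, show p ≤ p from le_rfl, hp⟩
    refine ⟨t, ⟨ht.1.2, fun q htq => ?_⟩, ht.1.1⟩
    by_contra hq
    exact absurd (ht.2 ⟨le_trans (show p ≤ t from ht.1.1) htq.le, hq⟩ htq.le) htq.not_ge
  have hdown : ∀ p ∈ U, ∃ r, r ≤ p ∧ (r ∉ U ∨ ∀ s, s ≤ r → s = r) := by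
    intro p hp
    by_cases h : ∃ r, r ≤ p ∧ r ∉ U
    · obtain ⟨r, hr, hrU⟩ := h
      exact ⟨r, hr, Or.inl hrU⟩
    · push Not at h
      obtain ⟨r, hr⟩ := (hUfin.subset (fun s (hs : s ∈ Set.Iic p) => h s hs)).exists_minimal
        ⟨p, show p ≤ p from le_rfl⟩
      exact ⟨r, hr.1, Or.inr fun s hs => le_antisymm hs (hr.2 (le_trans hs hr.1) hs)⟩
  choose! f hf hf' using hdown
  have hband : IsBand (T ∪ f '' U) := by
    refine ⟨hTfin.union (hUfin.image f), fun p => ?_⟩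
    by_cases hp : p ∈ U
    · exact ⟨f p, Or.inr ⟨p, hp, rfl⟩, Or.inr (hf p hp)⟩
    · obtain ⟨t, ht, hpt⟩ := hTtop p hp
      exact ⟨t, Or.inl ht, Or.inl hpt⟩
  have hlow : ∀ a ∈ T ∪ f '' U, a ∉ U ∨ ∀ s, s ≤ a → s = a := by
    rintro a (ha | ⟨p, hp, rfl⟩)
    · exact Or.inl ha.1
    · exact hf' p hp
  have key : ∀ B ⊆ B₁ ∪ B₂, IsBand B → ∀ a ∈ T ∪ f '' U, ∃ b ∈ B, a ≤ b := by
    intro B hBsub hB a ha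
    obtain ⟨b, hb, h | h⟩ := hB.2 a
    · exact ⟨b, hb, h⟩
    · rcases hlow a ha with h' | h'
      · exact absurd (hmemU b (hBsub hb) a h) h'
      · exact ⟨b, hb, (h' b h).ge⟩
  refine ⟨T ∪ f '' U, ⟨_, hband, fun b hb => ⟨b, hb, le_rfl⟩⟩, fun a ha => ?_, fun a ha => ?_⟩
  · obtain ⟨b, hb, hab⟩ := key B₁ Set.subset_union_left hB₁ a ha
    obtain ⟨c, hc, hbc⟩ := h₁ b hb
    exact ⟨c, hc, hab.trans hbc⟩
  · obtain ⟨b, hb, hab⟩ := key B₂ Set.subset_union_right hB₂ a ha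
    obtain ⟨c, hc, hbc⟩ := h₂ b hb
    exact ⟨c, hc, hab.trans hbc⟩

theorem IsOmega.exists_common_finite (hP : IsOmega P) {ι : Type*} {F : Set ι} (hF : F.Finite)
    (D : ι → Set P) (hD : ∀ i ∈ F, IsCap (D i)) {E : Set P} (hE : IsCap E) :
    ∃ A : Set P, IsCap A ∧ ∀ i ∈ F, ∀ a ∈ A, ∃ d ∈ D i, a ≤ d := by
  induction F, hF using Set.Finite.induction_on with
  | empty => exact ⟨E, hE, by simp⟩
  | @insert i s _ _ ih =>
    obtain ⟨A, hA, h⟩ := ih fun j hj => hD j (Set.mem_insert_of_mem _ hj)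
    obtain ⟨A', hA', h1, h2⟩ := hP.exists_common hA (hD i (Set.mem_insert _ _))
    refine ⟨A', hA', fun j hj a ha => ?_⟩
    rcases Set.mem_insert_iff.1 hj with rfl | hj
    · exact h2 a ha
    · obtain ⟨b, hb, hab⟩ := h1 a ha
      obtain ⟨d, hd, hbd⟩ := h j hj b hb
      exact ⟨d, hd, hab.trans hbd⟩

end Caps

/-! ### Basic facts about stars of relations -/

section Stars

variable {P Q R S : Type*} [PartialOrder P]

theorem star_mono {r s : Q → P → Prop} (h : ∀ q p, r q p → s q p) (q : Q) (p : P)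
    (hq : star r q p) : star s q p :=
  let ⟨C, hC, hle⟩ := hq
  ⟨C, hC, fun c hc => h q c (hle c hc)⟩

/-- It suffices to find a cap whose star at `p` lies `≤`-below elements related to `q`. -/
theorem star_of_le {r : Q → P → Prop} {q : Q} {p : P} {C : Set P} (hC : IsCap C)
    (h : ∀ c ∈ starOf C p, ∃ d, c ≤ d ∧ r q d) : star r q p := by
  refine ⟨{d | Compat d p → r q d}, hC.of_refines fun c hc => ?_, fun d hd => hd.1 hd.2⟩
  by_cases hcp : Compat c p
  · obtain ⟨d, hcd, hd⟩ := h c ⟨hc, hcp⟩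
    exact ⟨d, fun _ => hd, hcd⟩
  · exact ⟨c, fun h' => absurd h' hcp, le_rfl⟩

theorem starAbove_eq : (StarAbove : P → P → Prop) = star (· = ·) := by
  funext q p
  refine propext ⟨fun ⟨C, hC, h⟩ => star_of_le hC fun c hc => ⟨q, h c hc, rfl⟩, ?_⟩
  rintro ⟨C, hC, h⟩
  exact ⟨C, hC, fun c hc => (h c hc).ge⟩

theorem star_of_comp_starAbove {r : Q → P → Prop} {q : Q} {p : P}
    (h : Relation.Comp r StarAbove q p) : star r q p := by
  obtain ⟨d, hd, C, hC, hle⟩ := h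
  exact star_of_le hC fun c hc => ⟨d, hle c hc, hd⟩

theorem star_comp_starAbove_of_star (hP : IsRegular P) {r : Q → P → Prop} {q : Q} {p : P}
    (h : star r q p) : star (Relation.Comp r StarAbove) q p := by
  obtain ⟨C, hC, h⟩ := h
  obtain ⟨B, hB, hBC⟩ := hP C hC
  refine ⟨B, hB, fun b hb => ?_⟩
  obtain ⟨c, hc, hcb⟩ := hBC b hb.1
  exact ⟨c, h c ⟨hc, (hb.2.symm.starAbove hcb).symm⟩, hcb⟩

theorem star_star (hω : IsOmega P) (hP : IsRegular P) (r : Q → P → Prop) :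
    star (star r) = star r := by
  funext q p
  refine propext ⟨?_, fun h => star_mono (fun _ _ => star_of_comp_starAbove) q p
    (star_comp_starAbove_of_star hP h)⟩
  rintro ⟨C, hC, h⟩
  obtain ⟨F, hFC, hFfin, hF⟩ := hC.finite_subcap
  have h' : ∀ c ∈ starOf F p, star r q c := fun c hc => h c ⟨hFC hc.1, hc.2⟩
  choose! D hD hDr using h'
  obtain ⟨A, hA, hAD⟩ := hω.exists_common_finite (hFfin.subset fun c (hc : c ∈ starOf F p) => hc.1)
    D hD hC
  refine star_of_le hA fun a ha => ?_
  obtain ⟨c, hc, hac, hcp⟩ := ha.2.split hF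
  obtain ⟨d, hd, had⟩ := hAD c ⟨hc, hcp⟩ a ha.1
  exact ⟨d, had, hDr c ⟨hc, hcp⟩ d ⟨hd, hac.mono had le_rfl⟩⟩

theorem star_comp_of_comp_star {s : R → Q → Prop} {r : Q → P → Prop} {x : R} {p : P}
    (h : Relation.Comp s (star r) x p) : star (Relation.Comp s r) x p := by
  obtain ⟨q, hq, C, hC, h⟩ := h
  exact ⟨C, hC, fun c hc => ⟨q, hq, h c hc⟩⟩

theorem star_comp_star (hω : IsOmega P) (hP : IsRegular P) (s : R → Q → Prop)
    (r : Q → P → Prop) : star (Relation.Comp s (star r)) = star (Relation.Comp s r) := by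
  funext x p
  refine propext ⟨fun h => ?_, fun h => ?_⟩
  · rw [← star_star hω hP]
    exact star_mono (fun _ _ => star_comp_of_comp_star) x p h
  · refine star_mono (fun y c hy => ?_) x p (star_comp_starAbove_of_star hP h)
    obtain ⟨d, ⟨q, hyq, hqd⟩, hdc⟩ := hy
    exact ⟨q, hyq, star_of_comp_starAbove ⟨d, hqd, hdc⟩⟩

variable [PartialOrder Q]

theorem star_comp_of_star_comp {s : R → Q → Prop} {r : Q → P → Prop} (hr : IsRefiner r)
    (hw : WedgePreserving r) {x : R} {p : P} (h : Relation.Comp (star s) r x p) :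
    star (Relation.Comp s r) x p := by
  obtain ⟨q, ⟨C, hC, hs⟩, hqp⟩ := h
  obtain ⟨B, hB, hBC⟩ := hr C hC
  refine ⟨B, hB, fun b hb => ?_⟩
  obtain ⟨c, hc, hcb⟩ := hBC b hb.1
  exact ⟨c, hs c ⟨hc, hw hcb hb.2 hqp⟩, hcb⟩

theorem star_star_comp (hω : IsOmega P) (hP : IsRegular P) {s : R → Q → Prop}
    {r : Q → P → Prop} (hr : IsRefiner r) (hw : WedgePreserving r)
    (hs : ∀ x q, s x q → star s x q) :
    star (Relation.Comp (star s) r) = star (Relation.Comp s r) := by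
  funext x p
  refine propext ⟨fun h => ?_, star_mono (fun y c => ?_) x p⟩
  · rw [← star_star hω hP]
    exact star_mono (fun _ _ => star_comp_of_star_comp hr hw) x p h
  · rintro ⟨q, hyq, hqc⟩
    exact ⟨q, hs y q hyq, hqc⟩

variable [PartialOrder R]

theorem isRefiner_eq : IsRefiner (fun p q : P => p = q) :=
  fun C hC => ⟨C, hC, fun c hc => ⟨c, hc, rfl⟩⟩

theorem wedgePreserving_eq : WedgePreserving (fun p q : P => p = q) := by
  rintro q _ _ q' rfl h rfl
  exact h

theorem IsRefiner.comp {s : R → Q → Prop} {r : Q → P → Prop} (hs : IsRefiner s)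
    (hr : IsRefiner r) : IsRefiner (Relation.Comp s r) := by
  intro C hC
  obtain ⟨D, hD, h⟩ := hs C hC
  obtain ⟨E, hE, h'⟩ := hr D hD
  refine ⟨E, hE, fun e he => ?_⟩
  obtain ⟨d, hd, hde⟩ := h' e he
  obtain ⟨c, hc, hcd⟩ := h d hd
  exact ⟨c, hc, d, hcd, hde⟩

theorem WedgePreserving.comp {s : R → Q → Prop} {r : Q → P → Prop} (hs : WedgePreserving s)
    (hr : WedgePreserving r) : WedgePreserving (Relation.Comp s r) := by
  rintro x p p' x' ⟨q, hx, hq⟩ h ⟨q', hx', hq'⟩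
  exact hs hx (hr hq h hq') hx'

theorem IsRefiner.star (hP : IsRegular P) {r : Q → P → Prop} (hr : IsRefiner r) :
    IsRefiner (star r) := by
  intro C hC
  obtain ⟨D, hD, h⟩ := hr C hC
  obtain ⟨E, hE, h'⟩ := hP D hD
  refine ⟨E, hE, fun e he => ?_⟩
  obtain ⟨d, hd, hde⟩ := h' e he
  obtain ⟨c, hc, hcd⟩ := h d hd
  exact ⟨c, hc, star_of_comp_starAbove ⟨d, hcd, hde⟩⟩

theorem WedgePreserving.star {r : Q → P → Prop} (hr : WedgePreserving r) :
    WedgePreserving (star r) := by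
  rintro q p p' q' ⟨C, hC, h⟩ hpp ⟨C', hC', h'⟩
  obtain ⟨c, hc, hpc, hcp⟩ := hpp.split hC
  obtain ⟨c', hc', hcc, hcp'⟩ := hcp.split hC'
  exact hr (h c ⟨hc, hpc.symm⟩) hcc (h' c' ⟨hc', hcp'⟩)

theorem isRefiner_starAbove (hP : IsRegular P) :
    IsRefiner (StarAbove : P → P → Prop) := by
  rw [starAbove_eq]
  exact isRefiner_eq.star hP

theorem wedgePreserving_starAbove : WedgePreserving (StarAbove : P → P → Prop) := by
  rw [starAbove_eq]
  exact wedgePreserving_eq.star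

theorem starComp_starAbove (hω : IsOmega P) (hP : IsRegular P) (r : Q → P → Prop) :
    starComp r StarAbove = star r := by
  rw [starComp, starAbove_eq, star_comp_star hω hP, Relation.comp_eq]

theorem starAbove_starComp_starAbove (hω : IsOmega P) (hP : IsRegular P) :
    starComp StarAbove StarAbove = (StarAbove : P → P → Prop) := by
  rw [starComp_starAbove hω hP, starAbove_eq, star_star hω hP]

/-- `▷ * ⊐` satisfies the equation of strong refiners. -/
theorem starComp_idem (hω : IsOmega P) (hP : IsRegular P) (hω' : IsOmega Q)
    (hQ : IsRegular Q) {r : Q → P → Prop} (hr : IsRefiner r) (hw : WedgePreserving r) :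
    starComp StarAbove (starComp StarAbove r) = starComp StarAbove r := by
  have h1 : ∀ x y : Q, Relation.Comp StarAbove StarAbove x y →
      star (Relation.Comp StarAbove StarAbove) x y := by
    intro x y h
    have h2 := starAbove_starComp_starAbove hω' hQ
    rw [starComp] at h2
    rw [h2, starAbove_eq, ← star_star hω' hQ, ← starAbove_eq]
    exact star_of_comp_starAbove h
  have h3 := star_star_comp hω hP hr hw h1
  have h2 := starAbove_starComp_starAbove hω' hQ
  unfold starComp at h2 ⊢
  rw [star_comp_star hω hP, ← Relation.comp_assoc, ← h3, h2]

/-- Strong refiners are star-invariant. -/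
theorem star_eq_of_strong (hω : IsOmega P) (hP : IsRegular P) {r : Q → P → Prop}
    (h : r = starComp StarAbove r) : star r = r := by
  conv_lhs => rw [h, starComp, star_star hω hP]
  exact h.symm

theorem starComp_strong (hω : IsOmega P) (hP : IsRegular P) (hω' : IsOmega Q)
    (hQ : IsRegular Q) {s : R → Q → Prop} {r : Q → P → Prop}
    (hr : IsRefiner r) (hw : WedgePreserving r) (hs : s = starComp StarAbove s) :
    starComp s r = starComp StarAbove (starComp s r) := by
  have h1 : ∀ x q, Relation.Comp StarAbove s x q → star (Relation.Comp StarAbove s) x q := by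
    intro x q h
    rw [← star_eq_of_strong hω' hQ hs] at h
    exact star_comp_of_comp_star h
  have h2 := star_star_comp hω hP hr hw h1
  unfold starComp at hs ⊢
  rw [star_comp_star hω hP, ← Relation.comp_assoc, ← h2, ← hs]

theorem starComp_assoc (hω : IsOmega P) (hP : IsRegular P) (hω' : IsOmega Q)
    (hQ : IsRegular Q) {t : S → R → Prop} {s : R → Q → Prop} {r : Q → P → Prop}
    (hr : IsRefiner r) (hw : WedgePreserving r) (hs : s = starComp StarAbove s) :
    starComp t (starComp s r) = starComp (starComp t s) r := by
  have h1 : ∀ x q, Relation.Comp t s x q → star (Relation.Comp t s) x q := by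
    intro x q h
    rw [← star_eq_of_strong hω' hQ hs] at h
    exact star_comp_of_comp_star h
  unfold starComp
  rw [star_comp_star hω hP, star_star_comp hω hP hr hw h1, Relation.comp_assoc]

end Stars

/-! ### Basic facts about the spectrum -/

section Spectra

variable {P Q : Type*} [PartialOrder P] [PartialOrder Q]

theorem isSelector_iff_not_isCap_compl {S : Set P} : IsSelector S ↔ ¬ IsCap Sᶜ := by
  constructor
  · intro h hc
    obtain ⟨x, hx, hx'⟩ := h _ hc
    exact hx' hx
  · intro h C hC
    by_contra hne
    refine h (hC.of_refines fun c hc => ⟨c, fun hcS => hne ⟨c, hcS, hc⟩, le_rfl⟩)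

theorem IsSelector.exists_minimal {S : Set P} (hS : IsSelector S) :
    ∃ T ⊆ S, Minimal IsSelector T := by
  obtain ⟨T, hTS, hT⟩ := zorn_superset_nonempty {T : Set P | IsSelector T} (by
    intro c hc hchain hne
    refine ⟨⋂₀ c, ?_, fun s hs => Set.sInter_subset_of_mem hs⟩
    intro C hC
    obtain ⟨F, hFC, hFfin, hF⟩ := hC.finite_subcap
    by_contra hempty
    have hex : ∀ x ∈ F, ∃ s ∈ c, x ∉ s := by
      intro x hx
      by_contra hcon
      push Not at hcon
      exact hempty ⟨x, fun s hs => hcon s hs, hFC hx⟩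
    have hsel : ∀ G : Set P, G.Finite → (∀ x ∈ G, ∃ s ∈ c, x ∉ s) →
        ∃ s ∈ c, ∀ x ∈ G, x ∉ s := by
      intro G hG
      induction G, hG using Set.Finite.induction_on with
      | empty =>
        intro _
        obtain ⟨s, hs⟩ := hne
        exact ⟨s, hs, by simp⟩
      | @insert x G _ _ ih =>
        intro h
        obtain ⟨s, hs, hsG⟩ := ih fun y hy => h y (Set.mem_insert_of_mem _ hy)
        obtain ⟨t, ht, hxt⟩ := h x (Set.mem_insert _ _)
        rcases hchain.total hs ht with hst | hts
        · exact ⟨s, hs, fun y hy => (Set.mem_insert_iff.1 hy).elim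
            (fun hyx => hyx ▸ fun hxs => hxt (hst hxs)) (hsG y)⟩
        · exact ⟨t, ht, fun y hy => (Set.mem_insert_iff.1 hy).elim
            (fun hyx => hyx ▸ hxt) (fun hyG hyt => hsG y hyG (hts hyt))⟩
    obtain ⟨s, hs, hsF⟩ := hsel F hFfin hex
    obtain ⟨x, hxs, hxF⟩ := hc hs F hF
    exact hsF x hxF hxs) S hS
  exact ⟨T, hTS, hT⟩

theorem exists_cap_of_minimal {S : Set P} (hS : Minimal IsSelector S) {s : P} (hs : s ∈ S) :
    ∃ C : Set P, IsCap C ∧ ∀ c ∈ C, c ∈ S → c = s := by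
  by_contra hcon
  push Not at hcon
  have hsel : IsSelector (S \ {s}) := by
    intro C hC
    obtain ⟨c, hc, hcS, hcs⟩ := hcon C hC
    exact ⟨c, ⟨hcS, hcs⟩, hc⟩
  exact (hS.2 hsel Set.sdiff_subset hs).2 rfl

theorem mem_of_le_of_minimal {S : Set P} (hS : Minimal IsSelector S) {s p : P} (hs : s ∈ S)
    (hp : s ≤ p) : p ∈ S := by
  obtain ⟨C, hC, h⟩ := exists_cap_of_minimal hS hs
  have hD : IsCap ({c | c ∈ C ∧ c ≠ s} ∪ {p}) := hC.of_refines fun c hc => by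
    by_cases hcs : c = s
    · exact ⟨p, Or.inr rfl, hcs ▸ hp⟩
    · exact ⟨c, Or.inl ⟨hc, hcs⟩, le_rfl⟩
  obtain ⟨d, hdS, hd | hd⟩ := hS.1 _ hD
  · exact absurd (h d hd.1 hdS) hd.2
  · exact (show d = p from hd) ▸ hdS

/-- Minimal selectors in an ω-poset are linked. -/
theorem compat_of_minimal (hω : IsOmega P) {S : Set P} (hS : Minimal IsSelector S) {p q : P}
    (hp : p ∈ S) (hq : q ∈ S) : Compat p q := by
  obtain ⟨C, hC, h⟩ := exists_cap_of_minimal hS hp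
  obtain ⟨D, hD, h'⟩ := exists_cap_of_minimal hS hq
  obtain ⟨A, hA, hAC, hAD⟩ := hω.exists_common hC hD
  obtain ⟨a, haS, haA⟩ := hS.1 A hA
  obtain ⟨c, hc, hac⟩ := hAC a haA
  obtain ⟨d, hd, had⟩ := hAD a haA
  exact ⟨a, h c hc (mem_of_le_of_minimal hS haS hac) ▸ hac,
    h' d hd (mem_of_le_of_minimal hS haS had) ▸ had⟩

/-- Minimal selectors in a regular ω-poset are round. -/
theorem round_of_minimal (hω : IsOmega P) (hP : IsRegular P) {S : Set P}
    (hS : Minimal IsSelector S) {p : P} (hp : p ∈ S) : ∃ q ∈ S, StarAbove p q := by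
  obtain ⟨C, hC, h⟩ := exists_cap_of_minimal hS hp
  obtain ⟨D, hD, hDC⟩ := hP C hC
  obtain ⟨d, hdS, hdD⟩ := hS.1 D hD
  obtain ⟨c, hc, hcd⟩ := hDC d hdD
  have hcS : c ∈ S := by
    obtain ⟨E, hE, hle⟩ := hcd
    obtain ⟨e, heS, heE⟩ := hS.1 E hE
    exact mem_of_le_of_minimal hS heS (hle e ⟨heE, compat_of_minimal hω hS heS hdS⟩)
  exact ⟨d, hdS, h c hc hcS ▸ hcd⟩

/-- In a regular poset, linked selectors yield minimal selectors by taking up-closures with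
respect to the star-below relation. -/
theorem minimal_starUp (hP : IsRegular P) {S : Set P} (hS : IsSelector S)
    (hl : ∀ p ∈ S, ∀ q ∈ S, Compat p q) : Minimal IsSelector (starUp S) := by
  have hlink : ∀ p ∈ S, ∀ q ∈ starUp S, Compat p q := by
    rintro p hp q ⟨s, hs, hqs⟩
    exact (hl p hp s hs).starAbove hqs
  have hlink' : ∀ p ∈ starUp S, ∀ q ∈ starUp S, Compat p q := by
    rintro p hp q ⟨s, hs, hqs⟩
    exact (hlink s hs p hp).symm.starAbove hqs
  have hsel : IsSelector (starUp S) := by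
    intro C hC
    obtain ⟨B, hB, hBC⟩ := hP C hC
    obtain ⟨b, hbS, hbB⟩ := hS B hB
    obtain ⟨c, hc, hcb⟩ := hBC b hbB
    exact ⟨c, ⟨b, hbS, hcb⟩, hc⟩
  refine ⟨hsel, fun T hT hTS t ht => ?_⟩
  obtain ⟨s, hs, C, hC, hle⟩ := ht
  obtain ⟨B, hB, hBC⟩ := hP C hC
  obtain ⟨b, hbS, hbB⟩ := hsel B hB
  obtain ⟨c, hc, hcb⟩ := hBC b hbB
  have hcs : Compat c s := ((hlink s hs b hbS).starAbove hcb).symm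
  obtain ⟨D, hD, hDle⟩ := hcb.mono (hle c ⟨hc, hcs⟩)
  have hE : IsCap ({d | d ∈ D ∧ ¬ Compat d b} ∪ {t}) := hD.of_refines fun d hd => by
    by_cases hdb : Compat d b
    · exact ⟨t, Or.inr rfl, hDle d ⟨hd, hdb⟩⟩
    · exact ⟨d, Or.inl ⟨hd, hdb⟩, le_rfl⟩
  obtain ⟨e, heT, he | he⟩ := hT _ hE
  · exact absurd (hlink' e (hTS heT) b hbS) he.2
  · exact (show e = t from he) ▸ heT

theorem compactSpace_spectrum : CompactSpace (Spectrum P) := by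
  refine compactSpace_generateFrom rfl fun 𝒰 h𝒰 hcov => ?_
  let C : Set P := {p | {S : Spectrum P | p ∈ S.1} ∈ 𝒰}
  have hC : IsCap C := by
    by_contra hC
    have hsel : IsSelector Cᶜ := by rwa [isSelector_iff_not_isCap_compl, compl_compl]
    obtain ⟨T, hTC, hT⟩ := hsel.exists_minimal
    have hmem : (⟨T, hT⟩ : Spectrum P) ∈ ⋃₀ 𝒰 := hcov ▸ Set.mem_univ _
    obtain ⟨U, hU, hTU⟩ := hmem
    obtain ⟨p, rfl⟩ := h𝒰 hU
    exact hTC hTU hU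
  obtain ⟨F, hFC, hFfin, hF⟩ := hC.finite_subcap
  refine ⟨(fun p : P => {S : Spectrum P | p ∈ S.1}) '' F, ?_, hFfin.image _, ?_⟩
  · rintro _ ⟨p, hp, rfl⟩
    exact hFC hp
  · refine Set.eq_univ_of_forall fun S => ?_
    obtain ⟨p, hpS, hpF⟩ := S.2.1 F hF
    exact ⟨_, ⟨p, hpF, rfl⟩, hpS⟩

theorem isOpen_basic (p : P) : IsOpen {S : Spectrum P | p ∈ S.1} :=
  TopologicalSpace.isOpen_generateFrom_of_mem ⟨p, rfl⟩

theorem t2Space_spectrum (hω : IsOmega P) (hP : IsRegular P) : T2Space (Spectrum P) := by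
  refine ⟨fun S T hST => ?_⟩
  have hnot : ¬ S.1 ⊆ T.1 := fun h => hST (Spectrum.ext (h.antisymm (T.2.2 S.2.1 h)))
  obtain ⟨s, hsS, hsT⟩ := Set.not_subset.1 hnot
  obtain ⟨t, htS, C, hC, hle⟩ := round_of_minimal hω hP S.2 hsS
  obtain ⟨c, hcT, hc⟩ := T.2.1 C hC
  refine ⟨_, _, isOpen_basic t, isOpen_basic c, htS, hcT, ?_⟩
  rw [Set.disjoint_left]
  intro U hUt hUc
  exact hsT (mem_of_le_of_minimal T.2 hcT (hle c ⟨hc, compat_of_minimal hω U.2 hUc hUt⟩))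

theorem secondCountable_spectrum (hω : IsOmega P) :
    SecondCountableTopology (Spectrum P) := by
  have : Countable P := by
    rw [← Set.countable_univ_iff]
    refine (Set.countable_iUnion fun n : ℕ => (hω.2 n).countable).mono fun p _ => ?_
    exact Set.mem_iUnion.2 ⟨(Set.Ici p).ncard, rfl⟩
  exact ⟨_, Set.countable_range _, rfl⟩

theorem metrizableSpace_spectrum (hω : IsOmega P) (hP : IsRegular P) :
    TopologicalSpace.MetrizableSpace (Spectrum P) := by
  have := compactSpace_spectrum (P := P)
  have := t2Space_spectrum hω hP
  have := secondCountable_spectrum hω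
  infer_instance

theorem minimal_phi (hω : IsOmega P) (hQ : IsRegular Q) {r : Q → P → Prop} (hr : IsRefiner r)
    (hw : WedgePreserving r) (S : Spectrum P) :
    Minimal IsSelector (starUp (relUp r S.1)) := by
  refine minimal_starUp hQ (fun C hC => ?_) ?_
  · obtain ⟨D, hD, h⟩ := hr C hC
    obtain ⟨d, hdS, hd⟩ := S.2.1 D hD
    obtain ⟨c, hc, hcd⟩ := h d hd
    exact ⟨c, ⟨d, hdS, hcd⟩, hc⟩
  · rintro q ⟨p, hp, hqp⟩ q' ⟨p', hp', hqp'⟩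
    exact hw hqp (compat_of_minimal hω S.2 hp hp') hqp'

/-- The continuous map `φ_⊐ : S P → S Q` given by `φ_⊐(S) = S^{⊏◁}`. -/
def phi (hω : IsOmega P) (hQ : IsRegular Q) (r : Q → P → Prop) (hr : IsRefiner r)
    (hw : WedgePreserving r) : C(Spectrum P, Spectrum Q) where
  toFun S := ⟨starUp (relUp r S.1), minimal_phi hω hQ hr hw S⟩
  continuous_toFun := by
    refine continuous_generateFrom_iff.2 ?_
    rintro _ ⟨q, rfl⟩
    have : (fun S : Spectrum P =>
          (⟨starUp (relUp r S.1), minimal_phi hω hQ hr hw S⟩ : Spectrum Q)) ⁻¹'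
        {T : Spectrum Q | q ∈ T.1} =
        ⋃ (p : P) (_ : Relation.Comp StarAbove r q p), {S : Spectrum P | p ∈ S.1} := by
      ext S
      simp only [Set.mem_iUnion]
      constructor
      · rintro ⟨q', ⟨p, hp, hr'⟩, hq⟩
        exact ⟨p, ⟨q', hq, hr'⟩, hp⟩
      · rintro ⟨p, ⟨q', hq, hr'⟩, hp⟩
        exact ⟨q', ⟨p, hp, hr'⟩, hq⟩
    exact (congrArg IsOpen this).mpr
      (isOpen_iUnion fun p => isOpen_iUnion fun _ => isOpen_basic p)

end Spectra

/-! ### The categories -/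

/-- Regular prime ω-posets, the objects of the category `P` of regular prime ω-posets and
`∧`-preserving refiners. -/
structure CatP : Type (u + 1) where
  carrier : Type u
  [order : PartialOrder carrier]
  omega : IsOmega carrier
  regular : IsRegular carrier
  prime : IsPrime carrier

instance : CoeSort CatP.{u} (Type u) := ⟨CatP.carrier⟩

instance (X : CatP.{u}) : PartialOrder X := X.order

/-- A morphism from `X` to `Y` in `P` is a `∧`-preserving refiner `⊐ ⊆ Y × X`. -/
@[ext]
structure WedgeRefiner (X Y : CatP.{u}) where
  rel : Y → X → Prop
  isRefiner : IsRefiner rel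
  wedgePreserving : WedgePreserving rel

/-- The category `P`, with the usual composition of relations. -/
instance : Category CatP.{u} where
  Hom := WedgeRefiner
  id _ := ⟨(· = ·), isRefiner_eq, wedgePreserving_eq⟩
  comp f g := ⟨Relation.Comp g.rel f.rel, g.isRefiner.comp f.isRefiner,
    g.wedgePreserving.comp f.wedgePreserving⟩
  id_comp _ := WedgeRefiner.ext Relation.comp_eq
  comp_id _ := WedgeRefiner.ext Relation.eq_comp
  assoc _ _ _ := WedgeRefiner.ext Relation.comp_assoc.symm

/-- The category `S` has the same objects as `P`. -/
structure CatS : Type (u + 1) where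
  poset : CatP.{u}

/-- A morphism from `X` to `Y` in `S` is a strong refiner, i.e. a `∧`-preserving refiner
`⊐ ⊆ Y × X` such that `⊐ = ▷ * ⊐`. -/
@[ext]
structure StrongRefiner (X Y : CatP.{u}) extends WedgeRefiner X Y where
  strong : rel = starComp StarAbove rel

/-- The category `S`, with star-composition and with the star-above relations as identities. -/
instance : Category CatS.{u} where
  Hom X Y := StrongRefiner X.poset Y.poset
  id X := {
    rel := StarAbove
    isRefiner := isRefiner_starAbove X.poset.regular
    wedgePreserving := wedgePreserving_starAbove
    strong := (starAbove_starComp_starAbove X.poset.omega X.poset.regular).symm }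
  comp {X Y _} f g := {
    rel := starComp g.rel f.rel
    isRefiner := (g.isRefiner.comp f.isRefiner).star X.poset.regular
    wedgePreserving := (g.wedgePreserving.comp f.wedgePreserving).star
    strong := starComp_strong X.poset.omega X.poset.regular Y.poset.omega Y.poset.regular
      f.isRefiner f.wedgePreserving g.strong }
  id_comp {X _} f := StrongRefiner.ext <|
    (starComp_starAbove X.poset.omega X.poset.regular f.rel).trans
      (star_eq_of_strong X.poset.omega X.poset.regular f.strong)
  comp_id f := StrongRefiner.ext f.strong.symm
  assoc {W X _ _} f g _ := StrongRefiner.ext <|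
    starComp_assoc W.poset.omega W.poset.regular X.poset.omega X.poset.regular
      f.isRefiner f.wedgePreserving g.strong

/-- The category `K` of metrisable compact spaces and continuous maps. -/
abbrev CatK : Type (u + 1) :=
  CompHausLike.{u} fun X => TopologicalSpace.MetrizableSpace X

/-- The spectrum of a regular prime ω-poset as an object of `K`. -/
def spectrumObj (X : CatP.{u}) : CatK.{u} :=
  letI := compactSpace_spectrum (P := X)
  letI := t2Space_spectrum X.omega X.regular
  letI : CompHausLike.HasProp (fun X => TopologicalSpace.MetrizableSpace X) (Spectrum X) :=
    ⟨metrizableSpace_spectrum X.omega X.regular⟩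
  CompHausLike.of _ (Spectrum X)

/-- The morphism `φ_⊐` of `K` given by a `∧`-preserving refiner. -/
def spectrumMap {X Y : CatP.{u}} (f : WedgeRefiner X Y) : spectrumObj X ⟶ spectrumObj Y :=
  ConcreteCategory.ofHom (X := spectrumObj X) (Y := spectrumObj Y)
    (phi X.omega Y.regular f.rel f.isRefiner f.wedgePreserving)

/-- The map `S` from `P` to `K`, on objects and morphisms. -/
def spectrumP : CatP.{u} ⥤q CatK.{u} where
  obj X := spectrumObj X
  map f := spectrumMap f

/-- The restriction of the map `S` to the objects and morphisms of `S`. -/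
def spectrumS : CatS.{u} ⥤q CatK.{u} where
  obj X := spectrumObj X.poset
  map f := spectrumMap f.toWedgeRefiner

/-- The map `Q` from `P` to `S` with `Q(⊐) = ▷ * ⊐`. -/
def quotientMap : CatP.{u} ⥤q CatS.{u} where
  obj X := ⟨X⟩
  map {X Y} f := {
    rel := starComp StarAbove f.rel
    isRefiner := ((isRefiner_starAbove Y.regular).comp f.isRefiner).star X.regular
    wedgePreserving := (wedgePreserving_starAbove.comp f.wedgePreserving).star
    strong := (starComp_idem X.omega X.regular Y.omega Y.regular f.isRefiner
      f.wedgePreserving).symm }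

end OmegaPoset

namespace OmegaPoset

/-! ### Points of the spectrum and the maps induced by refiners. -/

section SpectrumPoints

variable {P Q R : Type*} [PartialOrder P] [PartialOrder Q] [PartialOrder R]

/-! In a regular ω-poset minimal selectors are round, linked and up-closed, so two of them are equal
once all their elements are pairwise compatible (`Spectrum.eq_of_forall_compat`). Every identity
between the maps `phi` thus reduces to a compatibility check. This gives functoriality, and it shows
that neither taking stars nor composing with ▷ changes the map (`phi_star`, `phi_starAbove`).

A strong refiner can be read off its map: q ⊐ p holds exactly when the closure of p^∈, represented
by `compatPoints p`, is sent into q^∈ (`strong_iff`). The caps needed for this come from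
compactness: the complement of a non-cap contains a minimal selector. Faithfulness follows.
Conversely, the same formula applied to any continuous map defines a strong refiner inducing that
map (`mapRel`, `phi_mapRel`), which is fullness. Faithfulness also reduces functoriality of ⊐ ↦ ▷ *
⊐ to that of the spectrum.

For essential surjectivity, a compact metrisable space has a sequence of finite open covers, each
refining the previous one and eventually refining every open cover. Ordering their members by
closure-inclusion between levels gives a poset whose caps are the sets refined by some level. Its
minimal selectors are the families of members containing a given point, so the space maps to the
spectrum by a continuous bijection, which is a homeomorphism. -/

theorem mem_of_starAbove_of_forall_compat {S : Set P} (hS : Minimal IsSelector S) {p q : P}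
    (h : StarAbove q p) (hp : ∀ s ∈ S, Compat s p) : q ∈ S := by
  obtain ⟨C, hC, hle⟩ := h
  obtain ⟨c, hcS, hc⟩ := hS.1 C hC
  exact mem_of_le_of_minimal hS hcS (hle c ⟨hc, hp c hcS⟩)

theorem mem_of_starAbove (hω : IsOmega P) {S : Set P} (hS : Minimal IsSelector S) {p q : P}
    (h : StarAbove q p) (hp : p ∈ S) : q ∈ S :=
  mem_of_starAbove_of_forall_compat hS h fun _ hs => compat_of_minimal hω hS hs hp

/-- Minimal selectors whose elements are pairwise compatible coincide. -/
theorem Spectrum.eq_of_forall_compat (hω : IsOmega P) (hP : IsRegular P) {S T : Spectrum P}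
    (h : ∀ s ∈ S.1, ∀ t ∈ T.1, Compat s t) : S = T := by
  have hST : S.1 ⊆ T.1 := fun s hs => by
    obtain ⟨s', hs', hss'⟩ := round_of_minimal hω hP S.2 hs
    exact mem_of_starAbove_of_forall_compat T.2 hss' fun t ht => (h s' hs' t ht).symm
  -- One inclusion suffices, because the larger selector is minimal.
  exact Spectrum.ext (hST.antisymm (T.2.2 S.2.1 hST))

/-- Minimal selectors in an ω-poset are down-directed. -/
theorem exists_mem_le_le (hω : IsOmega P) {S : Set P} (hS : Minimal IsSelector S) {p q : P}
    (hp : p ∈ S) (hq : q ∈ S) : ∃ a ∈ S, a ≤ p ∧ a ≤ q := by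
  obtain ⟨C, hC, h⟩ := exists_cap_of_minimal hS hp
  obtain ⟨D, hD, h'⟩ := exists_cap_of_minimal hS hq
  obtain ⟨A, hA, hAC, hAD⟩ := hω.exists_common hC hD
  obtain ⟨a, haS, haA⟩ := hS.1 A hA
  obtain ⟨c, hc, hac⟩ := hAC a haA
  obtain ⟨d, hd, had⟩ := hAD a haA
  exact ⟨a, haS, h c hc (mem_of_le_of_minimal hS haS hac) ▸ hac,
    h' d hd (mem_of_le_of_minimal hS haS had) ▸ had⟩

/-- The elements with a one-element principal filter are the maximal ones; they form a band, since
finite filters put every element below one of them. The point is that selectors are nonempty. -/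
theorem IsOmega.isCap_univ (hω : IsOmega P) : IsCap (Set.univ : Set P) := by
  refine ⟨{p | (Set.Ici p).ncard = 1}, ⟨hω.2 1, fun p => ?_⟩, fun b _ => ⟨b, trivial, le_rfl⟩⟩
  obtain ⟨m, hm⟩ := (hω.1 p).exists_maximal ⟨p, le_rfl⟩
  have hm' : Set.Ici m = {m} := Set.eq_singleton_iff_unique_mem.2
    ⟨le_rfl, fun q hq => le_antisymm (hm.2 (le_trans (show p ≤ m from hm.1) hq) hq) hq⟩
  exact ⟨m, by rw [Set.mem_ofPred_eq, hm', Set.ncard_singleton], Or.inl hm.1⟩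

/-- The sets `p^∈` with `p ∈ S` form a neighbourhood basis of `S`. -/
theorem exists_basic_subset (hω : IsOmega P) (S : Spectrum P) {U : Set (Spectrum P)}
    (hU : IsOpen U) (hS : S ∈ U) : ∃ p ∈ S.1, ∀ T : Spectrum P, p ∈ T.1 → T ∈ U := by
  induction hU with
  | basic V hV =>
    obtain ⟨p, rfl⟩ := hV
    exact ⟨p, hS, fun _ h => h⟩
  | univ =>
    obtain ⟨p, hp, _⟩ := S.2.1 _ hω.isCap_univ
    exact ⟨p, hp, fun _ _ => trivial⟩
  | inter V W _ _ ihV ihW =>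
    obtain ⟨p, hp, hpV⟩ := ihV hS.1
    obtain ⟨q, hq, hqW⟩ := ihW hS.2
    obtain ⟨a, ha, hap, haq⟩ := exists_mem_le_le hω S.2 hp hq
    exact ⟨a, ha, fun T hT => ⟨hpV T (mem_of_le_of_minimal T.2 hT hap),
      hqW T (mem_of_le_of_minimal T.2 hT haq)⟩⟩
  | sUnion 𝒱 _ ih =>
    obtain ⟨V, hV, hSV⟩ := hS
    obtain ⟨p, hp, h⟩ := ih V hV hSV
    exact ⟨p, hp, fun T hT => ⟨V, hV, h T hT⟩⟩

/-- Points of the image of `S` are detected by compatibility. -/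
theorem phi_eq_of_forall_compat (hω : IsOmega P) (hω' : IsOmega Q) (hQ : IsRegular Q)
    {r : Q → P → Prop} (hr : IsRefiner r) (hw : WedgePreserving r) {S : Spectrum P}
    {T : Spectrum Q} (h : ∀ p ∈ S.1, ∀ q, r q p → ∀ t ∈ T.1, Compat q t) :
    phi hω hQ r hr hw S = T := by
  refine Spectrum.eq_of_forall_compat hω' hQ ?_
  rintro x ⟨q, ⟨p, hp, hqp⟩, hxq⟩ t ht
  exact ((h p hp q hqp t ht).symm.starAbove hxq).symm

/-- Linkedness of S and `∧`-preservation give compatibility before the final ◁-closure, and ▷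
preserves compatibility. This feeds the criterion `phi_eq_of_forall_compat`. -/
theorem compat_of_rel_of_mem_phi (hω : IsOmega P) (hQ : IsRegular Q)
    {r : Q → P → Prop} (hr : IsRefiner r) (hw : WedgePreserving r) {S : Spectrum P}
    {p : P} (hp : p ∈ S.1) {q t : Q} (hqp : r q p) (ht : t ∈ (phi hω hQ r hr hw S).1) :
    Compat q t := by
  obtain ⟨q', ⟨p', hp', hq'⟩, htq⟩ := ht
  exact (hw hqp (compat_of_minimal hω S.2 hp hp') hq').starAbove htq

theorem phi_eq (hω : IsOmega P) (hP : IsRegular P) (S : Spectrum P) :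
    phi hω hP (· = ·) isRefiner_eq wedgePreserving_eq S = S := by
  refine phi_eq_of_forall_compat hω hω hP _ _ ?_
  rintro p hp _ rfl t ht
  exact compat_of_minimal hω S.2 hp ht

theorem phi_starAbove (hω : IsOmega P) (hP : IsRegular P) (S : Spectrum P) :
    phi hω hP StarAbove (isRefiner_starAbove hP) wedgePreserving_starAbove S = S :=
  phi_eq_of_forall_compat hω hω hP _ _ fun _ hp _ hqp _ ht =>
    compat_of_minimal hω S.2 (mem_of_starAbove hω S.2 hqp hp) ht

/-- Taking stars does not change the associated continuous map. -/
theorem phi_star (hω : IsOmega P) (hP : IsRegular P) (hω' : IsOmega Q) (hQ : IsRegular Q)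
    {r : Q → P → Prop} (hr : IsRefiner r) (hw : WedgePreserving r) (S : Spectrum P) :
    phi hω hQ (star r) (hr.star hP) hw.star S = phi hω hQ r hr hw S := by
  refine phi_eq_of_forall_compat hω hω' hQ _ _ ?_
  rintro p hp q ⟨C, hC, h⟩ t ht
  obtain ⟨c, hcS, hc⟩ := S.2.1 C hC
  exact compat_of_rel_of_mem_phi hω hQ hr hw hcS (h c ⟨hc, compat_of_minimal hω S.2 hcS hp⟩) ht

/-- The iterated image has an extra ◁ between the two relations, but compatibility does not see it.
-/
theorem phi_comp (hω : IsOmega P) (hω' : IsOmega Q) (hQ : IsRegular Q) (hω'' : IsOmega R)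
    (hR : IsRegular R) {s : R → Q → Prop} (hs : IsRefiner s) (hsw : WedgePreserving s)
    {r : Q → P → Prop} (hr : IsRefiner r) (hw : WedgePreserving r) (S : Spectrum P) :
    phi hω hR (Relation.Comp s r) (hs.comp hr) (hsw.comp hw) S =
      phi hω' hR s hs hsw (phi hω hQ r hr hw S) := by
  refine phi_eq_of_forall_compat hω hω'' hR _ _ ?_
  rintro p hp x ⟨q, hxq, hqp⟩ y ⟨x', ⟨q', hq', hx'q'⟩, hyx'⟩
  exact (hsw hxq (compat_of_rel_of_mem_phi hω hQ hr hw hp hqp hq') hx'q').starAbove hyx'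

/-! ### Recovering a strong refiner from its map. -/

/-- The points all of whose elements are compatible with `p`; in prime regular ω-posets this
is the closure of `p^∈`. -/
def compatPoints (p : P) : Set (Spectrum P) :=
  {S | ∀ s ∈ S.1, Compat s p}

theorem mem_compatPoints (hω : IsOmega P) {S : Spectrum P} {p : P} (hp : p ∈ S.1) :
    S ∈ compatPoints p :=
  fun _ hs => compat_of_minimal hω S.2 hs hp

/-- A relation `q ⊐* p` holds as soon as all points of `compatPoints p` contain an element
related to `q`. -/
theorem star_of_forall_compatPoints {Y : Type*} {r : Y → P → Prop} {q : Y} {p : P}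
    (h : ∀ S ∈ compatPoints p, ∃ s ∈ S.1, r q s) : star r q p := by
  -- The largest candidate cap: everything incompatible with p or related to q. Were it not a cap,
  -- its complement would contain a minimal selector; that point lies in `compatPoints p` yet has no
  -- element related to q.
  refine ⟨{d | Compat d p → r q d}, ?_, fun d hd => hd.1 hd.2⟩
  by_contra hcap
  have hsel : IsSelector {d | Compat d p → r q d}ᶜ := by
    rwa [isSelector_iff_not_isCap_compl, compl_compl]
  obtain ⟨T, hTD, hT⟩ := hsel.exists_minimal
  obtain ⟨s, hsT, hs⟩ := h ⟨T, hT⟩ fun s hs => by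
    by_contra hsp
    exact hTD hs fun h' => absurd h' hsp
  exact hTD hsT fun _ => hs

/-- A strong refiner is determined by its continuous map. -/
theorem strong_iff (hω : IsOmega P) (hQ : IsRegular Q) {r : Q → P → Prop} (hr : IsRefiner r)
    (hw : WedgePreserving r) (h : r = starComp StarAbove r) (q : Q) (p : P) :
    r q p ↔ ∀ S ∈ compatPoints p, q ∈ (phi hω hQ r hr hw S).1 := by
  constructor
  · intro hqp S hS
    -- Strength supplies a cap whose elements compatible with p all satisfy q ▷ q' ⊐ c for some q';
    -- a point of `compatPoints p` meets this cap in such a c.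
    rw [h] at hqp
    obtain ⟨C, hC, hle⟩ := hqp
    obtain ⟨c, hcS, hc⟩ := S.2.1 C hC
    obtain ⟨q', hqq', hq'c⟩ := hle c ⟨hc, hS c hcS⟩
    exact ⟨q', ⟨c, hcS, hq'c⟩, hqq'⟩
  · intro hqp
    rw [h]
    refine star_of_forall_compatPoints fun S hS => ?_
    obtain ⟨q', ⟨s, hs, hq's⟩, hqq'⟩ := hqp S hS
    exact ⟨s, hs, q', hqq', hq's⟩

/-! ### The strong refiner induced by a continuous map. -/

/-- The relation induced by a map of spectra: `q ⊐ p` iff `compatPoints p` is mapped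
into `q^∈`. -/
def mapRel (f : Spectrum P → Spectrum Q) (q : Q) (p : P) : Prop :=
  ∀ S ∈ compatPoints p, q ∈ (f S).1

theorem mapRel.mem (hω : IsOmega P) {f : Spectrum P → Spectrum Q} {q : Q} {p : P}
    (h : mapRel f q p) {S : Spectrum P} (hp : p ∈ S.1) : q ∈ (f S).1 :=
  h S (mem_compatPoints hω hp)

/-- Continuity gives t ∈ S with t^∈ sent into q^∈; roundness shrinks t to some s ◁ t, and then all
of `compatPoints s`, not just s^∈, lies in t^∈. -/
theorem exists_mapRel (hω : IsOmega P) (hP : IsRegular P) {f : Spectrum P → Spectrum Q}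
    (hf : Continuous f) {S : Spectrum P} {q : Q} (hq : q ∈ (f S).1) :
    ∃ s ∈ S.1, mapRel f q s := by
  obtain ⟨t, ht, htU⟩ := exists_basic_subset hω S ((isOpen_basic q).preimage hf) hq
  obtain ⟨s, hs, hts⟩ := round_of_minimal hω hP S.2 ht
  exact ⟨s, hs, fun T hT => htU T (mem_of_starAbove_of_forall_compat T.2 hts hT)⟩

theorem isRefiner_mapRel (hω : IsOmega P) (hP : IsRegular P) {f : Spectrum P → Spectrum Q}
    (hf : Continuous f) : IsRefiner (mapRel f) := by
  intro C hC
  refine ⟨{d | ∃ c ∈ C, mapRel f c d}, ?_, fun _ hd => hd⟩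
  by_contra hcap
  have hsel : IsSelector {d | ∃ c ∈ C, mapRel f c d}ᶜ := by
    rwa [isSelector_iff_not_isCap_compl, compl_compl]
  obtain ⟨T, hTD, hT⟩ := hsel.exists_minimal
  obtain ⟨c, hcT, hc⟩ := (f ⟨T, hT⟩).2.1 C hC
  obtain ⟨s, hs, hcs⟩ := exists_mapRel hω hP hf hcT
  exact hTD hs ⟨c, hc, hcs⟩

/-- Primeness enters here: a point through the common lower bound w has an image containing both q
and q'. -/
theorem wedgePreserving_mapRel (hω : IsOmega P) (hprime : IsPrime P) (hω' : IsOmega Q)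
    (f : Spectrum P → Spectrum Q) : WedgePreserving (mapRel f) := by
  rintro q p p' q' hqp ⟨w, hwp, hwp'⟩ hqp'
  obtain ⟨S, hS, hw⟩ := hprime w
  exact compat_of_minimal hω' (f ⟨S, hS⟩).2
    (hqp.mem hω (mem_of_le_of_minimal hS hw hwp)) (hqp'.mem hω (mem_of_le_of_minimal hS hw hwp'))

/-- Roundness of the point f S inserts an intermediate q' with q ▷ q', and `exists_mapRel` pulls q'
back to an element of S. -/
theorem strong_mapRel (hω : IsOmega P) (hP : IsRegular P) (hω' : IsOmega Q) (hQ : IsRegular Q)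
    {f : Spectrum P → Spectrum Q} (hf : Continuous f) :
    mapRel f = starComp StarAbove (mapRel f) := by
  funext q p
  refine propext ⟨fun h => star_of_forall_compatPoints fun S hS => ?_, ?_⟩
  · obtain ⟨q', hq', hqq'⟩ := round_of_minimal hω' hQ (f S).2 (h S hS)
    obtain ⟨s, hs, hq's⟩ := exists_mapRel hω hP hf hq'
    exact ⟨s, hs, q', hqq', hq's⟩
  · rintro ⟨C, hC, hle⟩ S hS
    obtain ⟨c, hcS, hc⟩ := S.2.1 C hC
    obtain ⟨q', hqq', hq'c⟩ := hle c ⟨hc, hS c hcS⟩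
    exact mem_of_starAbove hω' (f S).2 hqq' (hq'c.mem hω hcS)

theorem phi_mapRel (hω : IsOmega P) (hω' : IsOmega Q) (hQ : IsRegular Q)
    {f : Spectrum P → Spectrum Q} (hr : IsRefiner (mapRel f)) (hw : WedgePreserving (mapRel f))
    (S : Spectrum P) : phi hω hQ (mapRel f) hr hw S = f S :=
  phi_eq_of_forall_compat hω hω' hQ hr hw fun _ hp _ hqp _ ht =>
    compat_of_minimal hω' (f S).2 (hqp.mem hω hp) ht

end SpectrumPoints

/-! ### The functors -/

theorem spectrumMap_id (X : CatP.{u}) : spectrumMap (𝟙 X : X ⟶ X) = 𝟙 (spectrumObj X) :=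
  ConcreteCategory.hom_ext _ _ fun S => phi_eq X.omega X.regular S

theorem spectrumMap_comp {X Y Z : CatP.{u}} (f : X ⟶ Y) (g : Y ⟶ Z) :
    spectrumMap (f ≫ g) = spectrumMap f ≫ spectrumMap g :=
  ConcreteCategory.hom_ext _ _ fun S =>
    phi_comp X.omega Y.omega Y.regular Z.omega Z.regular g.isRefiner g.wedgePreserving
      f.isRefiner f.wedgePreserving S

/-- The functor from `P` to `K` taking spectra. -/
def spectrumFunctorP : CatP.{u} ⥤ CatK.{u} where
  obj := spectrumP.obj
  map := spectrumP.map
  map_id := spectrumMap_id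
  map_comp := spectrumMap_comp

theorem spectrumS_map_id (X : CatS.{u}) : spectrumS.map (𝟙 X) = 𝟙 (spectrumS.obj X) :=
  ConcreteCategory.hom_ext _ _ fun S => phi_starAbove X.poset.omega X.poset.regular S

theorem spectrumS_map_comp {X Y Z : CatS.{u}} (f : X ⟶ Y) (g : Y ⟶ Z) :
    spectrumS.map (f ≫ g) = spectrumS.map f ≫ spectrumS.map g :=
  ConcreteCategory.hom_ext _ _ fun S =>
    (phi_star X.poset.omega X.poset.regular Z.poset.omega Z.poset.regular
      (g.isRefiner.comp f.isRefiner)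
      (g.wedgePreserving.comp f.wedgePreserving) S).trans
    (phi_comp X.poset.omega Y.poset.omega Y.poset.regular Z.poset.omega Z.poset.regular
      g.isRefiner g.wedgePreserving f.isRefiner f.wedgePreserving S)

/-- The functor from `S` to `K` taking spectra. -/
def spectrumFunctorS : CatS.{u} ⥤ CatK.{u} where
  obj := spectrumS.obj
  map := spectrumS.map
  map_id := spectrumS_map_id
  map_comp := spectrumS_map_comp

/-- The formula in `strong_iff` depends on the relation only through its map. -/
theorem spectrumS_map_injective {X Y : CatS.{u}} :
    Function.Injective (spectrumS.map : (X ⟶ Y) → _) := by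
  intro f g hfg
  refine StrongRefiner.ext ?_
  funext q p
  have h : ∀ S : Spectrum X.poset,
      phi X.poset.omega Y.poset.regular f.rel f.isRefiner f.wedgePreserving S =
        phi X.poset.omega Y.poset.regular g.rel g.isRefiner g.wedgePreserving S :=
    fun S => ConcreteCategory.congr_hom hfg S
  refine propext ?_
  rw [strong_iff X.poset.omega Y.poset.regular f.isRefiner f.wedgePreserving f.strong,
    strong_iff X.poset.omega Y.poset.regular g.isRefiner g.wedgePreserving g.strong]
  simp only [h]

theorem spectrumS_map_surjective {X Y : CatS.{u}} :
    Function.Surjective (spectrumS.map : (X ⟶ Y) → _) := by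
  intro φ
  let f : C(Spectrum X.poset, Spectrum Y.poset) := ConcreteCategory.hom φ
  refine ⟨{
    rel := mapRel f
    isRefiner := isRefiner_mapRel X.poset.omega X.poset.regular f.continuous
    wedgePreserving := wedgePreserving_mapRel X.poset.omega X.poset.prime Y.poset.omega f
    strong := strong_mapRel X.poset.omega X.poset.regular Y.poset.omega Y.poset.regular
      f.continuous }, ?_⟩
  exact ConcreteCategory.hom_ext _ _ fun S =>
    phi_mapRel X.poset.omega Y.poset.omega Y.poset.regular
      (isRefiner_mapRel X.poset.omega X.poset.regular f.continuous)
      (wedgePreserving_mapRel X.poset.omega X.poset.prime Y.poset.omega f) S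

theorem spectrumS_map_quotientMap {X Y : CatP.{u}} (f : X ⟶ Y) :
    spectrumS.map (quotientMap.map f) = spectrumP.map f :=
  ConcreteCategory.hom_ext _ _ fun S =>
    (phi_star X.omega X.regular Y.omega Y.regular ((isRefiner_starAbove Y.regular).comp f.isRefiner)
      (wedgePreserving_starAbove.comp f.wedgePreserving) S).trans <|
    (phi_comp X.omega Y.omega Y.regular Y.omega Y.regular (isRefiner_starAbove Y.regular)
      wedgePreserving_starAbove f.isRefiner f.wedgePreserving S).trans <|
    phi_starAbove Y.omega Y.regular _

/-- The functor from `P` to `S` with `⊐ ↦ ▷ * ⊐`. -/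
def quotientFunctor : CatP.{u} ⥤ CatS.{u} where
  obj := quotientMap.obj
  map := quotientMap.map
  -- Both functor laws are checked after applying the faithful spectrum functor, where they become
  -- the laws already known on `CatP`.
  map_id X := spectrumS_map_injective <|
    (spectrumS_map_quotientMap (𝟙 X)).trans <|
      (spectrumMap_id X).trans (spectrumS_map_id ⟨X⟩).symm
  map_comp f g := spectrumS_map_injective <| by
    rw [spectrumS_map_comp, spectrumS_map_quotientMap, spectrumS_map_quotientMap,
      spectrumS_map_quotientMap]
    exact spectrumMap_comp f g

theorem spectrumFunctorP_eq : spectrumFunctorP.{u} = quotientFunctor ⋙ spectrumFunctorS :=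
  Functor.hext (fun _ => rfl) fun _ _ f => heq_of_eq (spectrumS_map_quotientMap f).symm

/-! ### Posets from sequences of covers -/

/-- A sequence of finite covers of `X` by nonempty open sets such that consecutive covers refine
each other in both directions and such that every open cover is eventually refined. -/
structure CoverSeq (X : Type*) [TopologicalSpace X] where
  cover : ℕ → Set (Set X)
  finite : ∀ n, (cover n).Finite
  isOpen : ∀ n, ∀ U ∈ cover n, IsOpen U
  nonempty : ∀ n, ∀ U ∈ cover n, U.Nonempty
  exists_mem : ∀ n x, ∃ U ∈ cover n, x ∈ U
  exists_above : ∀ n, ∀ V ∈ cover (n + 1), ∃ U ∈ cover n, closure V ⊆ U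
  exists_below : ∀ n, ∀ U ∈ cover n, ∃ V ∈ cover (n + 1), closure V ⊆ U
  fine : ∀ 𝒰 : Set (Set X), (∀ U ∈ 𝒰, IsOpen U) → (∀ x, ∃ U ∈ 𝒰, x ∈ U) →
    ∃ N, ∀ n ≥ N, ∀ V ∈ cover n, ∃ U ∈ 𝒰, closure V ⊆ U

/-! ### Cover sequences of compact metric spaces. -/

section Metric

variable {X : Type*} [MetricSpace X] [CompactSpace X]

/-- The new cover consists of the ρ-balls around a finite ρ-net, for ρ small enough. -/
theorem exists_finite_refinement {𝒞 : Set (Set X)} (hfin : 𝒞.Finite) (ho : ∀ U ∈ 𝒞, IsOpen U)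
    (hne : ∀ U ∈ 𝒞, U.Nonempty) (hcov : ∀ x, ∃ U ∈ 𝒞, x ∈ U) {δ : ℝ} (hδ : 0 < δ) :
    ∃ 𝒟 : Set (Set X), (𝒟.Finite ∧ (∀ U ∈ 𝒟, IsOpen U) ∧ (∀ U ∈ 𝒟, U.Nonempty) ∧
      ∀ x, ∃ U ∈ 𝒟, x ∈ U) ∧ (∀ V ∈ 𝒟, ∃ U ∈ 𝒞, closure V ⊆ U) ∧
      (∀ U ∈ 𝒞, ∃ V ∈ 𝒟, closure V ⊆ U) ∧ ∀ V ∈ 𝒟, ∃ x, V ⊆ Metric.ball x δ := by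
  obtain ⟨ε, hε, hball⟩ := lebesgue_number_lemma_of_metric_sUnion isCompact_univ ho
    fun x _ => hcov x
  have hinner : ∃ η > 0, ∀ U ∈ 𝒞, ∃ x, Metric.ball x η ⊆ U := by
    -- Subfamilies of the cover need not cover, so these facts must not enter the induction.
    clear hball hcov
    induction 𝒞, hfin using Set.Finite.induction_on with
    | empty => exact ⟨1, one_pos, by simp⟩
    | @insert U 𝒞 _ _ ih =>
      obtain ⟨η, hη, h⟩ := ih (fun V hV => ho V (Set.mem_insert_of_mem _ hV))
        fun V hV => hne V (Set.mem_insert_of_mem _ hV)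
      obtain ⟨x, hx⟩ := hne U (Set.mem_insert _ _)
      obtain ⟨η', hη', h'⟩ := Metric.isOpen_iff.1 (ho U (Set.mem_insert _ _)) x hx
      refine ⟨min η η', lt_min hη hη', fun V hV => ?_⟩
      rcases Set.mem_insert_iff.1 hV with rfl | hV
      · exact ⟨x, (Metric.ball_subset_ball (min_le_right _ _)).trans h'⟩
      · obtain ⟨y, hy⟩ := h V hV
        exact ⟨y, (Metric.ball_subset_ball (min_le_left _ _)).trans hy⟩
  obtain ⟨η, hη, hinner⟩ := hinner
  -- Below the Lebesgue number ε, closed ρ-balls fit into members of the cover; 2ρ < η puts the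
  -- closed ball of a net point near x inside the η-ball at x; ρ < δ controls the size.
  obtain ⟨ρ, hρ, hρε, hρη, hρδ⟩ : ∃ ρ > 0, ρ < ε ∧ 2 * ρ < η ∧ ρ < δ := by
    refine ⟨min ε (min η δ) / 3, by positivity, ?_, ?_, ?_⟩ <;>
    · have : 0 < min ε (min η δ) := by positivity
      have h1 := min_le_left ε (min η δ)
      have h2 := (min_le_right ε (min η δ)).trans (min_le_left η δ)
      have h3 := (min_le_right ε (min η δ)).trans (min_le_right η δ)
      linarith
  obtain ⟨t, htfin, ht⟩ := Metric.totallyBounded_iff.1 (isCompact_univ (X := X)).totallyBounded ρ hρ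
  have hcov' : ∀ x, ∃ y ∈ t, x ∈ Metric.ball y ρ := fun x => by
    simpa using ht (Set.mem_univ x)
  have hcl : ∀ y : X, closure (Metric.ball y ρ) ⊆ Metric.closedBall y ρ :=
    fun y => Metric.closure_ball_subset_closedBall
  refine ⟨(fun y => Metric.ball y ρ) '' t, ⟨htfin.image _, ?_, ?_, fun x => ?_⟩, ?_,
    fun U hU => ?_, ?_⟩
  · rintro _ ⟨y, _, rfl⟩
    exact Metric.isOpen_ball
  · rintro _ ⟨y, _, rfl⟩
    exact ⟨y, Metric.mem_ball_self hρ⟩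
  · obtain ⟨y, hy, hxy⟩ := hcov' x
    exact ⟨_, ⟨y, hy, rfl⟩, hxy⟩
  · rintro _ ⟨y, _, rfl⟩
    obtain ⟨U, hU, h⟩ := hball y trivial
    exact ⟨U, hU, (hcl y).trans ((Metric.closedBall_subset_ball hρε).trans h)⟩
  · obtain ⟨x, hx⟩ := hinner U hU
    obtain ⟨y, hy, hxy⟩ := hcov' x
    refine ⟨_, ⟨y, hy, rfl⟩, (hcl y).trans (Set.Subset.trans (fun z hz => ?_) hx)⟩
    rw [Metric.mem_ball] at hxy ⊢
    rw [Metric.mem_closedBall] at hz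
    have := dist_triangle_right z x y
    linarith
  · rintro _ ⟨y, _, rfl⟩
    exact ⟨y, Metric.ball_subset_ball hρδ.le⟩

variable (X) in
theorem nonempty_coverSeq_of_metric : Nonempty (CoverSeq X) := by
  let Good := {𝒞 : Set (Set X) // 𝒞.Finite ∧ (∀ U ∈ 𝒞, IsOpen U) ∧ (∀ U ∈ 𝒞, U.Nonempty) ∧
    ∀ x, ∃ U ∈ 𝒞, x ∈ U}
  have step : ∀ (n : ℕ) (𝒞 : Good), ∃ 𝒟 : Good, (∀ V ∈ 𝒟.1, ∃ U ∈ 𝒞.1, closure V ⊆ U) ∧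
      (∀ U ∈ 𝒞.1, ∃ V ∈ 𝒟.1, closure V ⊆ U) ∧
      ∀ V ∈ 𝒟.1, ∃ x, V ⊆ Metric.ball x (1 / ((n : ℝ) + 1)) := by
    rintro n ⟨𝒞, hfin, ho, hne, hcov⟩
    obtain ⟨𝒟, h𝒟, h⟩ := exists_finite_refinement hfin ho hne hcov
      (Nat.one_div_pos_of_nat (α := ℝ) (n := n))
    exact ⟨⟨𝒟, h𝒟⟩, h⟩
  choose next habove hbelow hsmall using step
  -- The cover by the whole space, or the empty family when the space is empty, as members must be
  -- nonempty.
  let base : Good := ⟨{U | U = Set.univ ∧ U.Nonempty},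
    (Set.finite_singleton Set.univ).subset fun U hU => hU.1,
    fun U hU => hU.1 ▸ isOpen_univ, fun U hU => hU.2,
    fun x => ⟨Set.univ, ⟨rfl, x, trivial⟩, trivial⟩⟩
  let C : ℕ → Good := fun n => Nat.rec base next n
  refine ⟨⟨fun n => (C n).1, fun n => (C n).2.1, fun n => (C n).2.2.1, fun n => (C n).2.2.2.1,
    fun n => (C n).2.2.2.2, fun n => habove n (C n), fun n => hbelow n (C n), ?_⟩⟩
  intro 𝒰 ho hcov
  obtain ⟨ε, hε, hball⟩ := lebesgue_number_lemma_of_metric_sUnion isCompact_univ ho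
    fun x _ => hcov x
  obtain ⟨N, hN⟩ := exists_nat_one_div_lt hε
  -- Cover m + 1 is made of sets inside balls of radius 1 / (m + 1), hence the shift by one.
  refine ⟨N + 1, fun n hn V hV => ?_⟩
  obtain ⟨m, rfl⟩ : ∃ m, n = m + 1 := ⟨n - 1, by omega⟩
  obtain ⟨x, hx⟩ := hsmall m (C m) V hV
  obtain ⟨U, hU, hxU⟩ := hball x trivial
  refine ⟨U, hU, (closure_mono hx).trans (Metric.closure_ball_subset_closedBall.trans
    ((Metric.closedBall_subset_ball ?_).trans hxU))⟩
  exact (Nat.one_div_le_one_div (by omega : N ≤ m)).trans_lt hN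

end Metric

theorem nonempty_coverSeq (X : Type*) [TopologicalSpace X] [CompactSpace X]
    [TopologicalSpace.MetrizableSpace X] : Nonempty (CoverSeq X) :=
  letI := TopologicalSpace.metrizableSpaceMetric X
  nonempty_coverSeq_of_metric X

/-! ### The poset of a cover sequence: order, caps and regularity. -/

namespace CoverSeq

variable {X : Type u} [TopologicalSpace X] (𝒞 : CoverSeq X)

/-- The poset of pairs `(n, U)` where `U` lies in the `n`-th cover. -/
def Poset : Type u :=
  {p : ℕ × Set X // p.2 ∈ 𝒞.cover p.1}

variable {𝒞}

/-- The index of the cover an element comes from. -/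
def Poset.level (p : 𝒞.Poset) : ℕ := p.1.1

/-- The underlying open set of an element. -/
def Poset.toSet (p : 𝒞.Poset) : Set X := p.1.2

theorem Poset.mem_cover (p : 𝒞.Poset) : p.toSet ∈ 𝒞.cover p.level := p.2

theorem Poset.isOpen (p : 𝒞.Poset) : IsOpen p.toSet := 𝒞.isOpen _ _ p.2

theorem Poset.nonempty (p : 𝒞.Poset) : p.toSet.Nonempty := 𝒞.nonempty _ _ p.2

/-- An element is strictly below another one if it comes from a later cover and the closure of
its set is contained in the larger set. -/
instance : PartialOrder 𝒞.Poset where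
  le p q := p = q ∨ (q.level < p.level ∧ closure p.toSet ⊆ q.toSet)
  le_refl _ := Or.inl rfl
  le_trans := by
    rintro p q r (rfl | ⟨h1, h2⟩) (rfl | ⟨h3, h4⟩)
    · exact Or.inl rfl
    · exact Or.inr ⟨h3, h4⟩
    · exact Or.inr ⟨h1, h2⟩
    · exact Or.inr ⟨h3.trans h1, h2.trans (subset_closure.trans h4)⟩
  le_antisymm := by
    rintro p q (rfl | ⟨h1, _⟩) (h | ⟨h3, _⟩)
    · rfl
    · rfl
    · exact h.symm
    · exact absurd h1 h3.asymm

namespace Poset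

theorem toSet_mono {p q : 𝒞.Poset} (h : p ≤ q) : p.toSet ⊆ q.toSet := by
  rcases h with rfl | h
  · exact subset_rfl
  · exact subset_closure.trans h.2

theorem level_anti {p q : 𝒞.Poset} (h : p ≤ q) : q.level ≤ p.level := by
  rcases h with rfl | h
  · exact le_rfl
  · exact h.1.le

theorem exists_level_mem (n : ℕ) (x : X) : ∃ p : 𝒞.Poset, p.level = n ∧ x ∈ p.toSet := by
  obtain ⟨U, hU, hx⟩ := 𝒞.exists_mem n x
  exact ⟨⟨(n, U), hU⟩, rfl, hx⟩

theorem exists_ge_level (p : 𝒞.Poset) {n : ℕ} (h : n ≤ p.level) : ∃ q, p ≤ q ∧ q.level = n := by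
  obtain ⟨k, hk⟩ := Nat.exists_eq_add_of_le h
  clear h
  induction k generalizing n with
  | zero => exact ⟨p, le_rfl, hk⟩
  | succ k ih =>
    obtain ⟨q, hpq, hq⟩ := @ih (n + 1) (by omega)
    obtain ⟨U, hU, hqU⟩ := 𝒞.exists_above n q.toSet (hq ▸ q.mem_cover)
    let v : 𝒞.Poset := ⟨(n, U), hU⟩
    have hqv : q ≤ v := Or.inr ⟨hq ▸ Nat.lt_succ_self n, hqU⟩
    exact ⟨v, hpq.trans hqv, rfl⟩

theorem exists_le_level (p : 𝒞.Poset) {n : ℕ} (h : p.level ≤ n) : ∃ q, q ≤ p ∧ q.level = n := by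
  induction n, h using Nat.le_induction with
  | base => exact ⟨p, le_rfl, rfl⟩
  | succ n _ ih =>
    obtain ⟨q, hqp, rfl⟩ := ih
    obtain ⟨V, hV, hVU⟩ := 𝒞.exists_below _ _ q.mem_cover
    let v : 𝒞.Poset := ⟨(q.level + 1, V), hV⟩
    have hvq : v ≤ q := Or.inr ⟨Nat.lt_succ_self _, hVU⟩
    exact ⟨v, hvq.trans hqp, rfl⟩

theorem finite_level (n : ℕ) : {p : 𝒞.Poset | p.level = n}.Finite := by
  refine Set.Finite.of_finite_image (f := toSet) ((𝒞.finite n).subset ?_) ?_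
  · rintro _ ⟨p, rfl, rfl⟩
    exact p.2
  · intro p hp q hq h
    exact Subtype.ext (Prod.ext (hp.trans hq.symm) h)

theorem finite_level_le (n : ℕ) : {p : 𝒞.Poset | p.level ≤ n}.Finite :=
  ((Set.finite_Iic n).biUnion fun k _ => finite_level k).subset fun p hp =>
    Set.mem_biUnion (x := p.level) hp rfl

/-- An element of level k has some element above it at each level up to k, so its filter has more
than k elements; a given filter size bounds the level. -/
theorem isOmega : IsOmega 𝒞.Poset := by
  have hfin : ∀ p : 𝒞.Poset, (Set.Ici p).Finite := fun p =>
    (finite_level_le p.level).subset fun _ hq => level_anti hq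
  refine ⟨hfin, fun n => (finite_level_le n).subset fun p hp => ?_⟩
  have hsub : Set.Iic p.level ⊆ level '' Set.Ici p := fun k hk => by
    obtain ⟨q, hpq, hq⟩ := p.exists_ge_level hk
    exact ⟨q, hpq, hq⟩
  have h1 := Set.ncard_le_ncard hsub ((hfin p).image _)
  have h2 := Set.ncard_image_le (f := level) (hfin p)
  have h3 : (Set.Iic p.level).ncard = p.level + 1 := by
    rw [Set.ncard_eq_toFinset_card', Set.toFinset_Iic, Nat.card_Iic]
  have h4 : (Set.Ici p).ncard = n := hp
  change p.level ≤ n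
  omega

theorem isCap_level (n : ℕ) : IsCap {p : 𝒞.Poset | p.level = n} := by
  refine ⟨_, ⟨finite_level n, fun p => ?_⟩, fun b hb => ⟨b, hb, le_rfl⟩⟩
  rcases le_total n p.level with h | h
  · obtain ⟨q, hq, hn⟩ := p.exists_ge_level h
    exact ⟨q, hn, Or.inl hq⟩
  · obtain ⟨q, hq, hn⟩ := p.exists_le_level h
    exact ⟨q, hn, Or.inr hq⟩

/-- Caps are the sets refined by some level. -/
theorem isCap_iff {C : Set 𝒞.Poset} :
    IsCap C ↔ ∃ n, ∀ p : 𝒞.Poset, p.level = n → ∃ c ∈ C, p ≤ c := by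
  refine ⟨?_, fun ⟨n, h⟩ => (isCap_level n).of_refines h⟩
  rintro ⟨B, ⟨hfin, hB⟩, hBC⟩
  -- Past all levels of the band, an element comparable to b can only be below b.
  obtain ⟨N, hN⟩ := (hfin.image level).bddAbove
  refine ⟨N + 1, fun p hp => ?_⟩
  obtain ⟨b, hb, h⟩ := hB p
  obtain ⟨c, hc, hbc⟩ := hBC b hb
  have hbN : b.level ≤ N := hN ⟨b, hb, rfl⟩
  rcases h with h | h
  · exact ⟨c, hc, h.trans hbc⟩
  · have := level_anti h
    omega

/-- A finite set of elements covering the space is a cap. -/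
theorem isCap_of_forall_mem {C : Set 𝒞.Poset} (hC : ∀ x, ∃ c ∈ C, x ∈ c.toSet)
    (hfin : C.Finite) : IsCap C := by
  obtain ⟨N, hN⟩ := 𝒞.fine (toSet '' C) (by rintro _ ⟨c, _, rfl⟩; exact c.isOpen) fun x => by
    obtain ⟨c, hc, hx⟩ := hC x
    exact ⟨_, ⟨c, hc, rfl⟩, hx⟩
  -- Closure-inclusion yields the order only from a strictly later level, so the levels of C must be
  -- bounded.
  obtain ⟨M, hM⟩ := (hfin.image level).bddAbove
  refine isCap_iff.2 ⟨max N (M + 1), fun p hp => ?_⟩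
  obtain ⟨_, ⟨c, hc, rfl⟩, hpc⟩ := hN p.level (hp ▸ le_max_left _ _) p.toSet p.mem_cover
  refine ⟨c, hc, Or.inr ⟨?_, hpc⟩⟩
  have : c.level ≤ M := hM ⟨c, hc, rfl⟩
  have := le_max_right N (M + 1)
  omega

/-- Sufficiently late elements meeting a closed subset of `q` are below `q`. -/
theorem exists_forall_le (q : 𝒞.Poset) {F : Set X} (hF : IsClosed F) (hFq : F ⊆ q.toSet) :
    ∃ N, ∀ p : 𝒞.Poset, N ≤ p.level → (p.toSet ∩ F).Nonempty → p ≤ q := by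
  -- A late member meeting F cannot lie in the complement of F, so its closure lies in q.
  obtain ⟨N, hN⟩ := 𝒞.fine {q.toSet, Fᶜ}
    (by rintro _ (rfl | rfl); exacts [q.isOpen, hF.isOpen_compl]) fun x => by
      by_cases hx : x ∈ F
      · exact ⟨_, Or.inl rfl, hFq hx⟩
      · exact ⟨_, Or.inr rfl, hx⟩
  refine ⟨max N (q.level + 1), fun p hp ⟨x, hxp, hxF⟩ => ?_⟩
  obtain ⟨_, rfl | rfl, h⟩ := hN p.level ((le_max_left _ _).trans hp) p.toSet p.mem_cover
  · exact Or.inr ⟨(le_max_right N (q.level + 1)).trans hp, h⟩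
  · exact absurd hxF (h (subset_closure hxp))

theorem toSet_inter_nonempty {p q : 𝒞.Poset} (h : Compat p q) :
    (p.toSet ∩ q.toSet).Nonempty := by
  obtain ⟨r, hp, hq⟩ := h
  obtain ⟨x, hx⟩ := r.nonempty
  exact ⟨x, toSet_mono hp hx, toSet_mono hq hx⟩

/-- Elements compatible with p meet the closure of p, so late ones are below q; a late level is the
required cap. -/
theorem starAbove_of_closure_subset {p q : 𝒞.Poset} (h : closure p.toSet ⊆ q.toSet) :
    StarAbove q p := by
  obtain ⟨N, hN⟩ := q.exists_forall_le isClosed_closure h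
  refine ⟨_, isCap_level N, fun c hc => hN c hc.1.ge ?_⟩
  exact (toSet_inter_nonempty hc.2).mono (Set.inter_subset_inter_right _ subset_closure)

/-- One level further down, each element is strictly below some level-n element, which gives the
closure-inclusion. -/
theorem isRegular : IsRegular 𝒞.Poset := by
  intro C hC
  obtain ⟨n, hn⟩ := isCap_iff.1 hC
  refine ⟨_, isCap_level (n + 1), fun d hd => ?_⟩
  have hd' : d.level = n + 1 := hd
  obtain ⟨q, hle, hq⟩ := d.exists_ge_level (n := n) (by omega)
  obtain ⟨c, hc, hpc⟩ := hn q hq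
  refine ⟨c, hc, starAbove_of_closure_subset ?_⟩
  rcases hle with rfl | h
  · omega
  · exact h.2.trans (toSet_mono hpc)

/-! ### The spectrum of the cover poset is the original space. -/

/-- The elements containing a given point. -/
def pointSet (x : X) : Set 𝒞.Poset := {p | x ∈ p.toSet}

theorem isSelector_pointSet (x : X) : IsSelector (pointSet x : Set 𝒞.Poset) := by
  intro C hC
  obtain ⟨n, hn⟩ := isCap_iff.1 hC
  obtain ⟨p, hp, hx⟩ := exists_level_mem (𝒞 := 𝒞) n x
  obtain ⟨c, hc, hpc⟩ := hn p hp
  exact ⟨c, toSet_mono hpc hx, hc⟩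

/-- If p contains x, late elements containing x are below p, so p together with all elements missing
x forms a cap. A selector whose elements all contain x can meet it only in p. -/
theorem minimal_pointSet [T1Space X] (x : X) :
    Minimal IsSelector (pointSet x : Set 𝒞.Poset) := by
  refine ⟨isSelector_pointSet x, fun T hT hTx p hp => ?_⟩
  obtain ⟨N, hN⟩ := p.exists_forall_le isClosed_singleton (Set.singleton_subset_iff.2 hp)
  have hcap : IsCap ({p} ∪ (pointSet x)ᶜ) := isCap_iff.2 ⟨N, fun q hq => by
    by_cases hx : x ∈ q.toSet
    · exact ⟨p, Or.inl rfl, hN q hq.ge ⟨x, hx, rfl⟩⟩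
    · exact ⟨q, Or.inr hx, le_rfl⟩⟩
  obtain ⟨t, htT, rfl | ht⟩ := hT _ hcap
  · exact htT
  · exact absurd (hTx htT) ht

theorem isPrime [T1Space X] : IsPrime 𝒞.Poset := fun p =>
  let ⟨x, hx⟩ := p.nonempty
  ⟨pointSet x, minimal_pointSet x, hx⟩

/-- The point of the spectrum given by a point of the space. -/
def toSpectrum [T1Space X] : C(X, Spectrum 𝒞.Poset) where
  toFun x := ⟨pointSet x, minimal_pointSet x⟩
  continuous_toFun := by
    refine continuous_generateFrom_iff.2 ?_
    rintro _ ⟨p, rfl⟩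
    exact p.isOpen

theorem toSpectrum_injective [T1Space X] :
    Function.Injective (toSpectrum : C(X, Spectrum 𝒞.Poset)) := by
  intro x y hxy
  by_contra hne
  -- No member of a late cover contains both x and y.
  obtain ⟨N, hN⟩ := 𝒞.fine {{x}ᶜ, {y}ᶜ}
    (by rintro _ (rfl | rfl) <;> exact isClosed_singleton.isOpen_compl) fun z => by
      by_cases hz : z = x
      · exact ⟨_, Or.inr rfl, fun h => hne (hz.symm.trans h)⟩
      · exact ⟨_, Or.inl rfl, hz⟩
  obtain ⟨p, hp, hx⟩ := exists_level_mem (𝒞 := 𝒞) N x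
  have hset : (pointSet x : Set 𝒞.Poset) = pointSet y := congrArg Spectrum.carrier hxy
  have hy : p ∈ (pointSet y : Set 𝒞.Poset) := hset ▸ hx
  obtain ⟨_, rfl | rfl, h⟩ := hN p.level hp.ge p.toSet p.mem_cover
  · exact h (subset_closure hx) rfl
  · exact h (subset_closure hy) rfl

/-- Otherwise every point lies in an element outside S; by compactness finitely many of these cover
the space and form a cap missing S. -/
theorem toSpectrum_surjective [T1Space X] [CompactSpace X] :
    Function.Surjective (toSpectrum : C(X, Spectrum 𝒞.Poset)) := by
  intro S
  suffices h : ∃ x, pointSet x ⊆ S.1 by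
    obtain ⟨x, hx⟩ := h
    exact ⟨x, Spectrum.ext (hx.antisymm (S.2.2 (isSelector_pointSet x) hx))⟩
  by_contra! hcon
  have hcon' : ∀ x, ∃ p : 𝒞.Poset, x ∈ p.toSet ∧ p ∉ S.1 := fun x => Set.not_subset.1 (hcon x)
  choose p hp hpS using hcon'
  obtain ⟨t, ht⟩ := isCompact_univ.elim_finite_subcover (fun x => (p x).toSet)
    (fun x => (p x).isOpen) fun x _ => Set.mem_iUnion.2 ⟨x, hp x⟩
  have hcap : IsCap (p '' t) := isCap_of_forall_mem (fun x => by
    obtain ⟨y, hy, hxy⟩ := Set.mem_iUnion₂.1 (ht (Set.mem_univ x))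
    exact ⟨_, ⟨y, hy, rfl⟩, hxy⟩) (t.finite_toSet.image p)
  obtain ⟨_, hS, ⟨x, _, rfl⟩⟩ := S.2.1 _ hcap
  exact hpS x hS

end Poset

end CoverSeq

/-- A continuous bijection between compact Hausdorff spaces is an isomorphism. -/
theorem spectrumFunctorS_essSurj : spectrumFunctorS.{u}.EssSurj := by
  refine ⟨fun K => ?_⟩
  have : TopologicalSpace.MetrizableSpace K := K.prop
  obtain ⟨𝒞⟩ := nonempty_coverSeq K
  let X : CatS.{u} := ⟨⟨𝒞.Poset, CoverSeq.Poset.isOmega, CoverSeq.Poset.isRegular,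
    CoverSeq.Poset.isPrime⟩⟩
  let f : K ⟶ spectrumFunctorS.obj X :=
    ConcreteCategory.ofHom (X := K) (Y := spectrumObj X.poset)
      (CoverSeq.Poset.toSpectrum : C(K, Spectrum 𝒞.Poset))
  exact ⟨X, ⟨(CompHausLike.isoOfBijective f
    ⟨CoverSeq.Poset.toSpectrum_injective, CoverSeq.Poset.toSpectrum_surjective⟩).symm⟩⟩

end OmegaPoset

theorem mainTheorem1 :
    ∃ (SP : OmegaPoset.CatP.{u} ⥤ OmegaPoset.CatK.{u})
      (SS : OmegaPoset.CatS.{u} ⥤ OmegaPoset.CatK.{u})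
      (Q : OmegaPoset.CatP.{u} ⥤ OmegaPoset.CatS.{u}),
      SP.toPrefunctor = OmegaPoset.spectrumP ∧
      SS.toPrefunctor = OmegaPoset.spectrumS ∧
      Q.toPrefunctor = OmegaPoset.quotientMap ∧
      SS.Full ∧ SS.Faithful ∧ SS.EssSurj ∧
      SP = Q ⋙ SS :=
  ⟨OmegaPoset.spectrumFunctorP, OmegaPoset.spectrumFunctorS, OmegaPoset.quotientFunctor,
    rfl, rfl, rfl, ⟨fun f => OmegaPoset.spectrumS_map_surjective f⟩,
    ⟨fun h => OmegaPoset.spectrumS_map_injective h⟩, OmegaPoset.spectrumFunctorS_essSurj,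
    OmegaPoset.spectrumFunctorP_eq⟩
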